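/- Let $d\in\{1,2\}$, let $B=B(0,1)$ be the open unit ball of $\mathbb{R}^d$, let $c>0$, and let $\Omega\subset B$ be open. Let $q:\mathbb{R}^d\to\mathbb{R}$ be measurable with $q=0$ a.e. outside $\Omega$ and $q_{\inf}\le q\le q_{\sup}$ a.e. in $\Omega$ for some constants $q_{\inf},q_{\sup}>0$. Put $$u(x)=\int_B e^{2ic\,x\cdot y}q(y)\,dy,\qquad (\mathcal N g)(t)=\int_B u\Big(\frac{t-s}{2}\Big)g(s)\,ds,\quad g\in L^2(B),$$ so that $\mathcal N$ is a bounded operator on the complex Hilbert space $L^2(B)$ (inner product $\langle\cdot,\cdot\rangle$, conjugate-linear in the second argument). Let $R=R(z,\epsilon)$ be a measurable region of positive measure $|R|$ (for example the cube or the ball with centre $z$ and size $\epsilon$) such that $\overline{R}\subset\Omega$, and put $$E_z=\frac{1}{|R|}1_{R},\qquad \phi_z(t)=\int_{\mathbb{R}^d}e^{ict\cdot y}E_z(y)\,dy\in L^2(B).$$ Then $\mathcal N$ has an eigensystem $\{\zeta_n,\mu_n\}_{n\ge0}$, that is, a complete orthonormal system $\{\zeta_n\}$ of $L^2(B)$ with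 $\mathcal N\zeta_n=\mu_n\zeta_n$ and $\mu_0\ge\mu_1\ge\cdots>0$. There is a unique $g_z^{FM}\in L^2(B)$ with $\mathcal N^{1/2}g_z^{FM}=\phi_z$, the function $E_z/q$ is integrable on $R$, and for every eigensystem $\{\zeta_n,\mu_n\}$ of $\mathcal N$ and every family of regularizing filters $f_\alpha:(0,\infty)\to\mathbb{R}$, $\alpha>0$ (each $f_\alpha$ is bounded, $\lim_{\alpha\to0}f_\alpha(\mu)=1/\mu$ for all $\mu>0$, and $|\mu f_\alpha(\mu)|\le d_0$ for all $\alpha,\mu>0$ with a constant $d_0$), the series $$\mathcal R_\alpha h=\sum_{n=0}^\infty f_\alpha(\mu_n^2)\,\mu_n\,\langle h,\zeta_n\rangle\,\zeta_n$$ converges in $L^2(B)$ for all $\alpha>0$ and $h\in L^2(B)$ and, with $g_{z,\alpha}=\mathcal R_\alpha\phi_z$, the following limit exists and $$|R(z,\epsilon)|\lim_{\alpha\to0}\langle g_{z,\alpha},\mathcal N g_{z,\alpha}\rangle=|R(z,\epsilon)|\,\|g_z^{FM}\|^2=\langle 1/q,E_z\rangle_{L^2(R(z,\epsilon))}=\int_{R(z,\epsilon)}\frac{E_z(y)}{q(y)}\,dy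 .$$ -/

import Mathlib

open MeasureTheory Filter Topology

namespace BornFM

/-- The space `ℝᵈ` with its Euclidean norm. -/
abbrev Rd (d : ℕ) : Type := EuclideanSpace ℝ (Fin d)

/-- The open unit interval / disk `B = B(0,1)` in `ℝᵈ`. -/
abbrev unitB (d : ℕ) : Set (Rd d) := Metric.ball 0 1

/-- Lebesgue measure restricted to `B`. -/
noncomputable abbrev measB (d : ℕ) : Measure (Rd d) := volume.restrict (unitB d)

/-- The complex Hilbert space `L²(B)`. Mathlib's `inner ℂ` is conjugate-linear in its first
argument, so the inner product `⟨g, h⟩` that is conjugate-linear in the second argument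
is `inner ℂ h g`. -/
abbrev L2B (d : ℕ) : Type := Lp ℂ 2 (measB d)

instance (d : ℕ) : IsFiniteMeasure (measB d) :=
  ⟨by rw [Measure.restrict_apply_univ]; exact measure_ball_lt_top⟩

/-! ### Oscillatory integrals -/

/-- The function `x ↦ ∫ exp (i a x·y) h(y) dν(y)`. -/
noncomputable def oscInt {d : ℕ} (ν : Measure (Rd d)) (a : ℝ) (h : Rd d → ℝ) (x : Rd d) : ℂ :=
  ∫ y, Complex.exp (Complex.I * ((a * inner ℝ x y : ℝ) : ℂ)) * (h y : ℂ) ∂ν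

theorem norm_oscInt_kernel {d : ℕ} (a : ℝ) (h : Rd d → ℝ) (x y : Rd d) :
    ‖Complex.exp (Complex.I * ((a * inner ℝ x y : ℝ) : ℂ)) * (h y : ℂ)‖ = ‖h y‖ := by
  rw [norm_mul, mul_comm Complex.I, Complex.norm_exp_ofReal_mul_I, one_mul, Complex.norm_real]

theorem norm_oscInt_le {d : ℕ} (ν : Measure (Rd d)) (a : ℝ) (h : Rd d → ℝ) (x : Rd d) :
    ‖oscInt ν a h x‖ ≤ ∫ y, ‖h y‖ ∂ν := by
  refine (norm_integral_le_integral_norm _).trans (le_of_eq ?_)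
  exact integral_congr_ae (Eventually.of_forall fun y => norm_oscInt_kernel a h x y)

theorem continuous_oscInt {d : ℕ} (ν : Measure (Rd d)) (a : ℝ) (h : Rd d → ℝ) :
    Continuous (oscInt ν a h) := by
  by_cases hh : Integrable h ν
  · refine continuous_of_dominated (bound := fun y => ‖h y‖) (fun x => ?_)
      (fun x => Eventually.of_forall fun y => (norm_oscInt_kernel a h x y).le) hh.norm
      (Eventually.of_forall fun y => by fun_prop)
    refine AEStronglyMeasurable.mul ?_
      (Complex.continuous_ofReal.comp_aestronglyMeasurable hh.aestronglyMeasurable)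
    exact Continuous.aestronglyMeasurable (by fun_prop)
  · have hzero : oscInt ν a h = fun _ => 0 := by
      funext x
      refine integral_undef fun hi => hh ?_
      have h2 : Integrable (fun y => Complex.exp (-(Complex.I * ((a * inner ℝ x y : ℝ) : ℂ))) *
          (Complex.exp (Complex.I * ((a * inner ℝ x y : ℝ) : ℂ)) * (h y : ℂ))) ν := by
        refine hi.bdd_mul (c := 1) (Continuous.aestronglyMeasurable (by fun_prop))
          (Eventually.of_forall fun y => ?_)
        rw [← mul_neg, ← Complex.ofReal_neg, mul_comm, Complex.norm_exp_ofReal_mul_I]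
      have h3 := h2.re
      refine h3.congr (Eventually.of_forall fun y => ?_)
      simp only [← mul_assoc, ← Complex.exp_add, neg_add_cancel, Complex.exp_zero, one_mul]
      simp
    rw [hzero]
    exact continuous_const

/-! ### Integral operators on `L²(B)` with a bounded continuous kernel -/

theorem integrable_kernel_mul {d : ℕ} {K : Rd d → Rd d → ℂ} (hK : Continuous (Function.uncurry K))
    {C : ℝ} (hC : ∀ t s, ‖K t s‖ ≤ C) (g : L2B d) (t : Rd d) :
    Integrable (fun s => K t s * g s) (measB d) := by
  refine ((Lp.memLp g).integrable (by norm_num)).bdd_mul (c := C) ?_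
    (Eventually.of_forall fun s => hC t s)
  exact (hK.comp (by fun_prop : Continuous fun s => (t, s))).aestronglyMeasurable

theorem norm_kernelInt_le {d : ℕ} {K : Rd d → Rd d → ℂ}
    {C : ℝ} (hC : ∀ t s, ‖K t s‖ ≤ C) (g : L2B d) (t : Rd d) :
    ‖∫ s, K t s * g s ∂(measB d)‖ ≤ C * ∫ s, ‖g s‖ ∂(measB d) := by
  have hg : Integrable (fun s => g s) (measB d) := (Lp.memLp g).integrable (by norm_num)
  rw [← integral_const_mul]
  refine norm_integral_le_of_norm_le (hg.norm.const_mul C) (Eventually.of_forall fun s => ?_)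
  rw [norm_mul]
  exact mul_le_mul_of_nonneg_right (hC t s) (norm_nonneg _)

theorem memLp_kernelInt {d : ℕ} {K : Rd d → Rd d → ℂ} (hK : Continuous (Function.uncurry K))
    {C : ℝ} (hC : ∀ t s, ‖K t s‖ ≤ C) (g : L2B d) :
    MemLp (fun t => ∫ s, K t s * g s ∂(measB d)) 2 (measB d) := by
  refine MemLp.of_bound (C := C * ∫ s, ‖g s‖ ∂(measB d)) ?_
    (Eventually.of_forall fun t => norm_kernelInt_le hC g t)
  have h1 : AEStronglyMeasurable (fun p : Rd d × Rd d => K p.1 p.2 * g p.2)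
      ((measB d).prod (measB d)) :=
    hK.aestronglyMeasurable.mul (Lp.aestronglyMeasurable g).comp_snd
  exact h1.integral_prod_right'

theorem integral_norm_le {d : ℕ} (g : L2B d) :
    ∫ s, ‖g s‖ ∂(measB d) ≤ (measB d).real Set.univ ^ (1 / 2 : ℝ) * ‖g‖ := by
  have hg := Lp.memLp g
  have h1 := eLpNorm_le_eLpNorm_mul_rpow_measure_univ (p := 1) (q := 2) (μ := measB d)
    (by norm_num) hg.1
  rw [integral_norm_eq_lintegral_enorm hg.1, ← eLpNorm_one_eq_lintegral_enorm, mul_comm, Lp.norm_def,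
    Measure.real, ENNReal.toReal_rpow, ← ENNReal.toReal_mul]
  refine ENNReal.toReal_mono ?_ (h1.trans (le_of_eq ?_))
  · exact ENNReal.mul_ne_top hg.2.ne
      (ENNReal.rpow_ne_top_of_nonneg (by norm_num) (measure_ne_top _ _))
  · norm_num

/-- The integral operator `(A g)(t) = ∫_B K(t,s) g(s) ds` on `L²(B)`. -/
noncomputable def kernelOp {d : ℕ} (K : Rd d → Rd d → ℂ) (hK : Continuous (Function.uncurry K))
    (C : ℝ) (hC : ∀ t s, ‖K t s‖ ≤ C) : L2B d →L[ℂ] L2B d :=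
  LinearMap.mkContinuous
    { toFun := fun g => (memLp_kernelInt hK hC g).toLp
      map_add' := fun g h => by
        rw [← MemLp.toLp_add]
        refine MemLp.toLp_congr _ _ (Eventually.of_forall fun t => ?_)
        simp only [Pi.add_apply]
        rw [← integral_add (integrable_kernel_mul hK hC g t) (integrable_kernel_mul hK hC h t)]
        refine integral_congr_ae ?_
        filter_upwards [Lp.coeFn_add g h] with s hs
        rw [hs, Pi.add_apply, mul_add]
      map_smul' := fun a g => by
        rw [RingHom.id_apply, ← MemLp.toLp_const_smul]
        refine MemLp.toLp_congr _ _ (Eventually.of_forall fun t => ?_)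
        simp only [Pi.smul_apply]
        rw [← integral_smul]
        refine integral_congr_ae ?_
        filter_upwards [Lp.coeFn_smul a g] with s hs
        rw [hs, Pi.smul_apply, smul_eq_mul, smul_eq_mul, mul_left_comm] }
    ((measB d).real Set.univ ^ (1 / 2 : ℝ) * (C * (measB d).real Set.univ ^ (1 / 2 : ℝ)))
    (fun g => by
      have hC0 : 0 ≤ C := (norm_nonneg _).trans (hC 0 0)
      have h := Lp.norm_le_of_ae_bound (p := 2) (f := (memLp_kernelInt hK hC g).toLp)
        (C := C * ∫ s, ‖g s‖ ∂(measB d))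
        (mul_nonneg hC0 (integral_nonneg fun _ => norm_nonneg _))
        (by
          filter_upwards [(memLp_kernelInt hK hC g).coeFn_toLp] with t ht
          rw [ht]
          exact norm_kernelInt_le hC g t)
      refine h.trans ?_
      have e : (measB d).real Set.univ ^ ((2 : ENNReal).toReal)⁻¹
          = (measB d).real Set.univ ^ (1 / 2 : ℝ) := by norm_num
      have e2 : (measureUnivNNReal (measB d) : ℝ) = (measB d).real Set.univ := rfl
      rw [e2, e, mul_assoc, mul_assoc]
      exact mul_le_mul_of_nonneg_left (mul_le_mul_of_nonneg_left (integral_norm_le g) hC0)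
        (by positivity))

/-! ### The data, the data operator, the test function -/

/-- The data `u(x) = ∫_B exp (2 i c x·y) q(y) dy`. -/
noncomputable def data {d : ℕ} (c : ℝ) (q : Rd d → ℝ) (x : Rd d) : ℂ :=
  oscInt (measB d) (2 * c) q x

/-- The data operator `(N g)(t) = ∫_B u((t - s)/2) g(s) ds` on `L²(B)`. -/
noncomputable def dataOp {d : ℕ} (c : ℝ) (q : Rd d → ℝ) : L2B d →L[ℂ] L2B d :=
  kernelOp (fun t s => data c q ((2 : ℝ)⁻¹ • (t - s)))
    ((continuous_oscInt (measB d) (2 * c) q).comp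
      (by fun_prop : Continuous fun p : Rd d × Rd d => (2 : ℝ)⁻¹ • (p.1 - p.2)))
    (∫ y, ‖q y‖ ∂(measB d)) (fun _ _ => norm_oscInt_le _ _ _ _)

/-- The normalized indicator function `E = 1_R / |R|`. -/
noncomputable def normInd {d : ℕ} (R : Set (Rd d)) (y : Rd d) : ℝ :=
  (volume.real R)⁻¹ * R.indicator (fun _ => 1) y

/-- The test function `φ(t) = ∫_{ℝᵈ} exp (i c t·y) E(y) dy`, as an element of `L²(B)`. -/
noncomputable def testFun {d : ℕ} (c : ℝ) (R : Set (Rd d)) : L2B d :=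
  MemLp.toLp (oscInt volume c (normInd R))
    (MemLp.of_bound (μ := measB d)
      (continuous_oscInt volume c (normInd R)).aestronglyMeasurable
      (∫ y, ‖normInd R y‖) (Eventually.of_forall fun t => norm_oscInt_le _ _ _ t))

/-- The square root `N^{1/2}` of a positive bounded operator on a complex Hilbert space
(continuous functional calculus). -/
noncomputable def opSqrt {H : Type*} [NormedAddCommGroup H] [InnerProductSpace ℂ H]
    [CompleteSpace H] (N : H →L[ℂ] H) : H →L[ℂ] H :=
  CFC.sqrt N

/-! ### Eigensystems and regularization schemes -/

/-- `(ζₙ, μₙ)` is an eigensystem of `N`: a complete orthonormal system `ζ` of eigenvectors,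
with positive eigenvalues in non-increasing order (repeated according to multiplicity). -/
structure IsEigensystem {d : ℕ} (N : L2B d →L[ℂ] L2B d) (ζ : HilbertBasis ℕ ℂ (L2B d))
    (μ : ℕ → ℝ) : Prop where
  eigen : ∀ n, N (ζ n) = (μ n : ℂ) • ζ n
  antitone : Antitone μ
  pos : ∀ n, 0 < μ n

/-- A family of regularizing filters `f α : (0, ∞) → ℝ`, `α > 0`, with constant `d₀`
(the values of `f α` outside `(0, ∞)` play no role). -/
structure IsRegularizingFilter (f : ℝ → ℝ → ℝ) (d₀ : ℝ) : Prop where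
  bounded : ∀ α, 0 < α → ∃ M : ℝ, ∀ x, 0 < x → |f α x| ≤ M
  tendsto : ∀ x, 0 < x → Tendsto (fun α => f α x) (𝓝[>] 0) (𝓝 (1 / x))
  bound : ∀ α, 0 < α → ∀ x, 0 < x → |x * f α x| ≤ d₀

/-- The `n`-th term `f_α(μₙ²) μₙ ⟨h, ζₙ⟩ ζₙ` of the regularization scheme. -/
noncomputable def regTerm {d : ℕ} (ζ : HilbertBasis ℕ ℂ (L2B d)) (μ : ℕ → ℝ) (f : ℝ → ℝ → ℝ)
    (α : ℝ) (h : L2B d) (n : ℕ) : L2B d :=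
  ((f α (μ n ^ 2) * μ n : ℝ) : ℂ) • (inner ℂ (ζ n) h : ℂ) • ζ n

/-- The regularization scheme `R_α h = ∑ₙ f_α(μₙ²) μₙ ⟨h, ζₙ⟩ ζₙ`. -/
noncomputable def regularize {d : ℕ} (ζ : HilbertBasis ℕ ℂ (L2B d)) (μ : ℕ → ℝ)
    (f : ℝ → ℝ → ℝ) (α : ℝ) (h : L2B d) : L2B d :=
  ∑' n, regTerm ζ μ f α h n

end BornFM

/-! Write `F_a` for the truncated Fourier operator with kernel `exp (i a t·s)` on `L²(B)`. Splitting
the phase of `u((t - s)/2)` gives `N = F_c M_q F_{-c}`, and `F_c` is the adjoint of `F_{-c}`. As `q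
≥ 0` a.e., `N = A† A` with `A = M_{√q} F_{-c}`. Likewise `φ = F_c E = A† h` with `h = E / √q`, and
`|R| ‖h‖² = ∫_R E / q` because `|R| E = 1` on `R` (`exists_factorization`).

Since `‖N^{1/2} x‖ = ‖A x‖`, the map `A x ↦ N^{1/2} x` is isometric. If `h` lies in the closed range
of `A`, then `A† h = N^{1/2} g` for some `g` with `‖g‖ = ‖h‖` (`exists_opSqrt_eq_adjoint_apply`). It
does: `A† y = 0` forces `√q y = 0` by injectivity of `F_c`, so `y = 0` a.e. on `R`, where `h` lives.
Uniqueness of `g` is injectivity of `A`: a truncated Fourier transform is entire along lines, so it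
cannot vanish on the open set `Ω` unless its argument is zero.

The eigensystem comes from the spectral theorem for the compact, positive, injective operator `N`.
In it, `⟨φ, ζₙ⟩ = √μₙ ⟨g, ζₙ⟩`, so the regularized energy is `∑ (μₙ² f_α(μₙ²))² |⟨g, ζₙ⟩|²`. Each
factor tends to 1 and is at most `d₀²`, and dominated convergence gives `‖g‖²`. -/

namespace BornFM

open scoped InnerProductSpace ComplexOrder FourierTransform ContDiff

/-! ### Square roots of positive operators and polar decomposition -/

section SquareRoot

variable {H G : Type*} [NormedAddCommGroup H] [InnerProductSpace ℂ H] [CompleteSpace H]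
  [NormedAddCommGroup G] [InnerProductSpace ℂ G] [CompleteSpace G]

theorem opSqrt_apply_opSqrt {N : H →L[ℂ] H} (hN : N.IsPositive) (x : H) :
    opSqrt N (opSqrt N x) = N x := by
  have h := CFC.sqrt_mul_sqrt_self N ((ContinuousLinearMap.nonneg_iff_isPositive N).2 hN)
  exact congrArg (fun T : H →L[ℂ] H => T x) h

theorem isPositive_opSqrt (N : H →L[ℂ] H) : (opSqrt N).IsPositive :=
  (ContinuousLinearMap.nonneg_iff_isPositive _).1 (CFC.sqrt_nonneg N)

theorem inner_opSqrt_opSqrt {N : H →L[ℂ] H} (hN : N.IsPositive) (x y : H) :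
    ⟪opSqrt N x, opSqrt N y⟫_ℂ = ⟪N x, y⟫_ℂ := by
  rw [← opSqrt_apply_opSqrt hN x]
  exact ((isPositive_opSqrt N).isSymmetric _ _).symm

/-- Both squares equal `⟪A† A x, x⟫`. This is the isometry behind the polar decomposition below. -/
theorem norm_opSqrt_adjoint_comp_self (A : H →L[ℂ] G) (x : H) :
    ‖opSqrt (A.adjoint ∘L A) x‖ = ‖A x‖ := by
  have h := inner_opSqrt_opSqrt (ContinuousLinearMap.isPositive_adjoint_comp_self A) x x
  rw [ContinuousLinearMap.comp_apply, ContinuousLinearMap.adjoint_inner_left,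
    inner_self_eq_norm_sq_to_K, inner_self_eq_norm_sq_to_K] at h
  exact (sq_eq_sq₀ (norm_nonneg _) (norm_nonneg _)).1 (by exact_mod_cast h)

/-- Polar decomposition on the range: a vector orthogonal to the kernel of `A†` is carried by `A†`
to the same place as some vector of the same norm is by `(A† A)^{1/2}`. -/
theorem exists_opSqrt_eq_adjoint_apply (A : H →L[ℂ] G) {k : G}
    (hk : ∀ y, A.adjoint y = 0 → ⟪y, k⟫_ℂ = 0) :
    ∃ g : H, opSqrt (A.adjoint ∘L A) g = A.adjoint k ∧ ‖g‖ = ‖k‖ := by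
  -- The orthogonal complement of `ker A†` is the closure of the range of `A`.
  have hmem : k ∈ closure (Set.range A) := by
    have h1 : k ∈ (A.range)ᗮᗮ := by
      rw [Submodule.mem_orthogonal]
      intro y hy
      rw [ContinuousLinearMap.orthogonal_range] at hy
      exact hk y hy
    rw [Submodule.orthogonal_orthogonal_eq_closure] at h1
    exact h1
  obtain ⟨y, hy, hlim⟩ := mem_closure_iff_seq_limit.1 hmem
  choose x hx using hy
  have hlim' : Tendsto (fun n => A (x n)) atTop (𝓝 k) := by simpa only [hx] using hlim
  -- The `x n` themselves need not converge; only their images under `A`, and hence under the square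
  -- root, do.
  have hcauchy : CauchySeq fun n => opSqrt (A.adjoint ∘L A) (x n) := by
    have hA := hlim'.cauchySeq
    rw [Metric.cauchySeq_iff] at hA ⊢
    intro ε hε
    obtain ⟨n₀, hn₀⟩ := hA ε hε
    refine ⟨n₀, fun m hm n hn => ?_⟩
    have := hn₀ m hm n hn
    rwa [dist_eq_norm, ← map_sub, ← norm_opSqrt_adjoint_comp_self, map_sub, ← dist_eq_norm] at this
  obtain ⟨g, hg⟩ := cauchySeq_tendsto_of_complete hcauchy
  refine ⟨g, ?_, ?_⟩
  · have h1 := ((opSqrt (A.adjoint ∘L A)).continuous.tendsto g).comp hg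
    have h2 := (A.adjoint.continuous.tendsto k).comp hlim'
    refine tendsto_nhds_unique h1 (h2.congr fun n => ?_)
    exact (opSqrt_apply_opSqrt (ContinuousLinearMap.isPositive_adjoint_comp_self A) (x n)).symm
  · refine tendsto_nhds_unique hg.norm (hlim'.norm.congr fun n => ?_)
    exact (norm_opSqrt_adjoint_comp_self A (x n)).symm

/-- The square root of a positive operator acts on an eigenvector by the square root of the
eigenvalue. -/
theorem opSqrt_apply_eigenvector {N : H →L[ℂ] H} (hN : N.IsPositive) {v : H} {μ : ℝ} (hμ : 0 < μ)
    (hv : N v = (μ : ℂ) • v) : opSqrt N v = (Real.sqrt μ : ℂ) • v := by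
  set w := opSqrt N v - (Real.sqrt μ : ℂ) • v with hw
  -- `(√N + √μ)(√N - √μ) v = N v - μ v = 0`. Pairing with `w` and using `√N ≥ 0` gives `√μ ‖w‖² ≤
  -- 0`.
  have h1 : opSqrt N w + (Real.sqrt μ : ℂ) • w = 0 := by
    rw [hw, map_sub, map_smul, opSqrt_apply_opSqrt hN, hv, smul_sub, smul_smul, ← Complex.ofReal_mul,
      Real.mul_self_sqrt hμ.le]
    abel
  have h2 := congrArg (fun z => RCLike.re ⟪z, w⟫_ℂ) h1
  have h3 := (isPositive_opSqrt N).re_inner_nonneg_left w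
  simp only [inner_add_left, inner_smul_left, map_add, inner_zero_left, Complex.conj_ofReal,
    inner_self_eq_norm_sq_to_K, map_zero] at h2
  have h4 : RCLike.re ((Real.sqrt μ : ℂ) * ((‖w‖ : ℂ)) ^ 2) = Real.sqrt μ * ‖w‖ ^ 2 := by
    rw [← Complex.ofReal_pow, ← Complex.ofReal_mul]; exact Complex.ofReal_re _
  have h5 : 0 < Real.sqrt μ := Real.sqrt_pos.2 hμ
  have h6 : ‖w‖ ^ 2 = 0 := by
    have h7 : RCLike.re ⟪opSqrt N w, w⟫_ℂ + Real.sqrt μ * ‖w‖ ^ 2 = 0 := by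
      rw [← h4]; exact h2
    have := mul_nonneg h5.le (sq_nonneg ‖w‖)
    have h8 : Real.sqrt μ * ‖w‖ ^ 2 = 0 := by linarith
    exact (mul_eq_zero.1 h8).resolve_left h5.ne'
  exact sub_eq_zero.1 (norm_eq_zero.1 (pow_eq_zero_iff two_ne_zero |>.1 h6))

end SquareRoot

/-! ### Enumeration in non-increasing order -/

section Ordering

/-- A family of positive reals with finitely many members above every positive level can be
enumerated in non-increasing order. -/
theorem exists_equiv_antitone {ι : Type*} [Infinite ι] (l : ι → ℝ) (hpos : ∀ i, 0 < l i)
    (hfin : ∀ ε, 0 < ε → {i | ε ≤ l i}.Finite) : ∃ e : ℕ ≃ ι, Antitone (l ∘ e) := by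
  classical
  -- Larger values come first, ties being broken by a well-order. Every index then has finitely many
  -- predecessors, and counting them embeds `ι` in `ℕ`.
  let r : ι → ι → Prop := fun j i => l i < l j ∨ (l j = l i ∧ WellOrderingRel j i)
  have hr_le : ∀ {j i}, r j i → l i ≤ l j := fun h => h.elim le_of_lt fun h => h.1.ge
  have hr_trans : ∀ {a b c}, r a b → r b c → r a c := by
    rintro a b c (h | ⟨h, h'⟩) (k | ⟨k, k'⟩)
    · exact Or.inl (k.trans h)
    · exact Or.inl (k ▸ h)
    · exact Or.inl (h ▸ k)
    · exact Or.inr ⟨h.trans k, _root_.trans h' k'⟩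
  have hr_irrefl : ∀ a, ¬ r a a := by
    rintro a (h | ⟨-, h⟩)
    · exact lt_irrefl _ h
    · exact irrefl_of WellOrderingRel a h
  have hr_total : ∀ a b, a ≠ b → r a b ∨ r b a := by
    intro a b hab
    rcases lt_trichotomy (l a) (l b) with h | h | h
    · exact Or.inr (Or.inl h)
    · rcases trichotomous_of WellOrderingRel a b with k | k | k
      · exact Or.inl (Or.inr ⟨h, k⟩)
      · exact absurd k hab
      · exact Or.inr (Or.inr ⟨h.symm, k⟩)
    · exact Or.inl (Or.inl h)
  have hpred : ∀ i, {j | r j i}.Finite := fun i =>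
    (hfin (l i) (hpos i)).subset fun j hj => hr_le hj
  let rank : ι → ℕ := fun i => (hpred i).toFinset.card
  have hrank : ∀ {a b}, r a b → rank a < rank b := by
    intro a b hab
    refine Finset.card_lt_card ((Finset.ssubset_iff_of_subset ?_).2 ⟨a, by simpa using hab, ?_⟩)
    · intro j hj
      simp only [Set.Finite.mem_toFinset, Set.mem_ofPred_eq] at hj ⊢
      exact hr_trans hj hab
    · simpa using hr_irrefl a
  have hinj : Function.Injective rank := by
    intro a b hab
    by_contra hne
    rcases hr_total a b hne with h | h
    · exact (hrank h).ne hab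
    · exact (hrank h).ne hab.symm
  have : Infinite (Set.range rank) := Set.infinite_coe_iff.2 (Set.infinite_range_of_injective hinj)
  let o := Nat.Subtype.orderIsoOfNat (Set.range rank)
  let f := Equiv.ofInjective rank hinj
  refine ⟨o.toEquiv.trans f.symm, antitone_nat_of_succ_le fun n => ?_⟩
  have hval : ∀ n, rank (f.symm (o n)) = (o n : ℕ) := fun n =>
    congrArg Subtype.val (f.apply_symm_apply (o n))
  have hlt : rank (f.symm (o n)) < rank (f.symm (o (n + 1))) := by
    rw [hval, hval]
    exact o.strictMono n.lt_succ_self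
  have hne : f.symm (o n) ≠ f.symm (o (n + 1)) := fun h => hlt.ne (congrArg rank h)
  rcases hr_total _ _ hne with h | h
  · exact hr_le h
  · exact absurd (hrank h) hlt.asymm

end Ordering

/-! ### Spectral theorem for compact, positive, injective operators -/

section Spectral

variable {H : Type*} [NormedAddCommGroup H] [InnerProductSpace ℂ H]

/-- A compact operator has only finitely many orthonormal eigenvectors with eigenvalue above a
positive level. -/
theorem finite_eigenvalues_ge {T : H →L[ℂ] H} (hT : IsCompactOperator T) {ι : Type*} {v : ι → H}
    (hv : Orthonormal ℂ v) {l : ι → ℝ} (hl : ∀ i, T (v i) = (l i : ℂ) • v i) {ε : ℝ} (hε : 0 < ε) :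
    {i | ε ≤ l i}.Finite := by
  by_contra hinf
  have hinf' : {i | ε ≤ l i}.Infinite := hinf
  let f := hinf'.natEmbedding
  have hmem : ∀ n, T (v (f n)) ∈ closure (T '' Metric.closedBall 0 1) := fun n =>
    subset_closure ⟨_, by simp [hv.1], rfl⟩
  obtain ⟨a, -, φ, hφ, hlim⟩ := (hT.isCompact_closure_image_closedBall 1).tendsto_subseq hmem
  have hC := hlim.cauchySeq
  rw [Metric.cauchySeq_iff] at hC
  obtain ⟨n₀, hn₀⟩ := hC ε hε
  have h1 := hn₀ n₀ le_rfl (n₀ + 1) (Nat.le_succ _)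
  set i := f (φ n₀) with hi
  set j := f (φ (n₀ + 1)) with hj
  have hij : (i : ι) ≠ j := fun h =>
    (hφ n₀.lt_succ_self).ne (f.injective (Subtype.ext h))
  simp only [Function.comp_apply] at h1
  rw [dist_eq_norm, ← hi, ← hj, hl, hl] at h1
  -- By orthogonality, images of distinct eigenvectors are at distance at least `l i ≥ ε`, so no
  -- subsequence of them is Cauchy.
  have h2 : ⟪v i, (l i : ℂ) • v i - (l j : ℂ) • v j⟫_ℂ = l i := by
    rw [inner_sub_right, inner_smul_right, inner_smul_right, hv.2 hij,
      inner_self_eq_norm_sq_to_K, hv.1]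
    simp
  have h3 := norm_inner_le_norm (𝕜 := ℂ) (v i) ((l i : ℂ) • v i - (l j : ℂ) • v j)
  rw [h2, hv.1, one_mul, Complex.norm_real] at h3
  have h4 : ε ≤ l i := i.2
  have h5 := le_abs_self (l i)
  rw [Real.norm_eq_abs] at h3
  linarith

variable [CompleteSpace H]

/-- The eigenspaces of a compact self-adjoint operator are mutually orthogonal with dense span.
Injectivity makes the kernel trivial, so all of them are finite-dimensional and their bases can be
concatenated. -/
theorem exists_orthonormal_eigenvectors {T : H →L[ℂ] H} (hT : IsCompactOperator T)
    (hpos : T.IsPositive) (hinj : ∀ x, T x = 0 → x = 0) :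
    ∃ (ι : Type) (b : HilbertBasis ι ℂ H) (l : ι → ℝ),
      (∀ i, 0 < l i) ∧ ∀ i, T (b i) = (l i : ℂ) • b i := by
  have hsym := hpos.isSymmetric
  let V : ℂ → Submodule ℂ H := fun μ => Module.End.eigenspace (T : Module.End ℂ H) μ
  have hV : ∀ μ (x : V μ), T x = μ • (x : H) := fun μ x => Module.End.mem_eigenspace_iff.1 x.2
  have hfd : ∀ μ, FiniteDimensional ℂ (V μ) := by
    intro μ
    rcases eq_or_ne μ 0 with rfl | hμ
    · have : V 0 = ⊥ := by
        rw [eq_bot_iff]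
        intro x hx
        exact hinj x (by simpa using hV 0 ⟨x, hx⟩)
      rw [this]
      infer_instance
    · exact ContinuousLinearMap.finite_dimensional_eigenspace hT μ hμ
  let ob : ∀ μ, OrthonormalBasis (Fin (Module.finrank ℂ (V μ))) ℂ (V μ) := fun μ =>
    stdOrthonormalBasis ℂ (V μ)
  -- The index `μ` runs over all complex numbers; non-eigenvalues contribute the empty `Fin 0`.
  let κ := Σ μ, Fin (Module.finrank ℂ (V μ))
  let v : κ → H := fun p => (ob p.1 p.2 : H)
  have hv : Orthonormal ℂ v :=
    hsym.orthogonalFamily_eigenspaces.orthonormal_sigma_orthonormal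
      (fun μ => (ob μ).orthonormal)
  have hspan : (Submodule.span ℂ (Set.range v))ᗮ = ⊥ := by
    rw [eq_bot_iff, ← ContinuousLinearMap.orthogonalComplement_iSup_eigenspaces_eq_bot hT hsym]
    refine Submodule.orthogonal_le (iSup_le fun μ x hx => ?_)
    have h := congrArg (Subtype.val) ((ob μ).sum_repr ⟨x, hx⟩)
    simp only [Submodule.coe_sum, Submodule.coe_smul] at h
    rw [← h]
    exact Submodule.sum_mem _ fun i _ =>
      Submodule.smul_mem _ _ (Submodule.subset_span ⟨⟨μ, i⟩, rfl⟩)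
  let b := HilbertBasis.mkOfOrthogonalEqBot hv hspan
  have hb : ∀ p, b p = v p := fun p => by rw [HilbertBasis.coe_mkOfOrthogonalEqBot]
  have heig : ∀ p, T (v p) = p.1 • v p := fun p => hV p.1 (ob p.1 p.2)
  have hval : ∀ p, ⟪v p, T (v p)⟫_ℂ = p.1 := fun p => by
    rw [heig, inner_smul_right, inner_self_eq_norm_sq_to_K, hv.1]; simp
  have hnn : ∀ p : κ, 0 ≤ p.1 := fun p => hval p ▸ hpos.inner_nonneg_right (v p)
  have hre : ∀ p : κ, ((p.1.re : ℝ) : ℂ) = p.1 := fun p =>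
    (Complex.eq_re_of_ofReal_le (r := 0) (by rw [Complex.ofReal_zero]; exact hnn p)).symm
  refine ⟨κ, b, fun p => p.1.re, fun p => ?_, fun p => ?_⟩
  · refine lt_of_le_of_ne (Complex.le_def.1 (hnn p)).1 fun h => ?_
    have h0 : p.1 = 0 := by rw [← hre p]; exact_mod_cast h.symm
    have h1 := hinj (v p) (by rw [heig, h0, zero_smul])
    have h2 := hv.1 p
    rw [h1, norm_zero] at h2
    exact zero_ne_one h2
  · rw [hb, hre, heig]

/-- **Spectral theorem** for an injective positive compact operator on an infinite-dimensional
Hilbert space, with the eigenvalues in non-increasing order. -/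
theorem exists_hilbertBasis_eigenvectors {T : H →L[ℂ] H} (hT : IsCompactOperator T)
    (hpos : T.IsPositive) (hinj : ∀ x, T x = 0 → x = 0) (hdim : ¬ FiniteDimensional ℂ H) :
    ∃ (b : HilbertBasis ℕ ℂ H) (l : ℕ → ℝ),
      (∀ i, T (b i) = (l i : ℂ) • b i) ∧ Antitone l ∧ ∀ i, 0 < l i := by
  obtain ⟨ι, b, l, hl, hb⟩ := exists_orthonormal_eigenvectors hT hpos hinj
  have : Infinite ι := by
    by_contra hfin
    rw [not_infinite_iff_finite] at hfin
    have := Fintype.ofFinite ι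
    exact hdim (Module.Basis.finiteDimensional_of_finite b.toOrthonormalBasis.toBasis)
  obtain ⟨e, he⟩ := exists_equiv_antitone l hl fun ε hε =>
    finite_eigenvalues_ge hT b.orthonormal hb hε
  have hspan : (Submodule.span ℂ (Set.range (b ∘ e)))ᗮ = ⊥ := by
    rw [e.surjective.range_comp, ← Submodule.topologicalClosure_eq_top_iff]
    exact b.dense_span
  refine ⟨HilbertBasis.mkOfOrthogonalEqBot (b.orthonormal.comp e e.injective) hspan, l ∘ e,
    fun i => ?_, he, fun i => hl _⟩
  rw [HilbertBasis.coe_mkOfOrthogonalEqBot]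
  exact hb (e i)

end Spectral

/-! ### Convergence of the regularization scheme -/

section Regularization

variable {d : ℕ}

/-- A bounded multiplier in a Hilbert basis defines a convergent series. -/
theorem hasSum_multiplier {H : Type*} [NormedAddCommGroup H] [InnerProductSpace ℂ H]
    (ζ : HilbertBasis ℕ ℂ H) {m : ℕ → ℂ} {M : ℝ} (hm : ∀ n, ‖m n‖ ≤ M) (h : H) :
    ∃ x : H, HasSum (fun n => m n • ⟪ζ n, h⟫_ℂ • ζ n) x ∧
      ∀ n, ⟪ζ n, x⟫_ℂ = m n * ⟪ζ n, h⟫_ℂ := by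
  have hmem : Memℓp (fun n => m n * ζ.repr h n) 2 := by
    have h2 : (0 : ℝ) < (2 : ENNReal).toReal := by norm_num
    rw [memℓp_gen_iff h2]
    have h1 := ((memℓp_gen_iff h2).1 (lp.memℓp (ζ.repr h))).mul_left (M ^ (2 : ENNReal).toReal)
    refine Summable.of_nonneg_of_le (fun n => by positivity) (fun n => ?_) h1
    have hM : 0 ≤ M := (norm_nonneg _).trans (hm n)
    rw [norm_mul, Real.mul_rpow (norm_nonneg _) (norm_nonneg _)]
    gcongr
    exact hm n
  refine ⟨ζ.repr.symm ⟨_, hmem⟩, ?_, fun n => ?_⟩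
  · have h1 := ζ.hasSum_repr_symm ⟨_, hmem⟩
    simpa only [smul_smul, ζ.repr_apply_apply] using h1
  · rw [← ζ.repr_apply_apply, LinearIsometryEquiv.apply_symm_apply, ← ζ.repr_apply_apply]

/-- For fixed `α` the filter is bounded and `μ n ≤ μ 0`. The bound may depend on `α`; it serves only
convergence of the series. -/
theorem IsRegularizingFilter.exists_multiplier_bound {f : ℝ → ℝ → ℝ} {d₀ : ℝ}
    (hf : IsRegularizingFilter f d₀) {μ : ℕ → ℝ} (hμ : Antitone μ) (hpos : ∀ n, 0 < μ n)
    {α : ℝ} (hα : 0 < α) : ∃ M : ℝ, ∀ n, ‖((f α (μ n ^ 2) * μ n : ℝ) : ℂ)‖ ≤ M := by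
  obtain ⟨M, hM⟩ := hf.bounded α hα
  refine ⟨M * μ 0, fun n => ?_⟩
  rw [Complex.norm_real, Real.norm_eq_abs, abs_mul, abs_of_pos (hpos n)]
  have h1 := hM (μ n ^ 2) (pow_pos (hpos n) 2)
  exact mul_le_mul h1 (hμ n.zero_le) (hpos n).le ((abs_nonneg _).trans h1)

theorem summable_regTerm {N : L2B d →L[ℂ] L2B d} {ζ : HilbertBasis ℕ ℂ (L2B d)} {μ : ℕ → ℝ}
    (hN : IsEigensystem N ζ μ) {f : ℝ → ℝ → ℝ} {d₀ : ℝ} (hf : IsRegularizingFilter f d₀)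
    {α : ℝ} (hα : 0 < α) (h : L2B d) : Summable (regTerm ζ μ f α h) := by
  obtain ⟨M, hM⟩ := hf.exists_multiplier_bound hN.antitone hN.pos hα
  obtain ⟨x, hx, -⟩ := hasSum_multiplier ζ hM h
  exact hx.summable

theorem inner_regularize {N : L2B d →L[ℂ] L2B d} {ζ : HilbertBasis ℕ ℂ (L2B d)} {μ : ℕ → ℝ}
    (hN : IsEigensystem N ζ μ) {f : ℝ → ℝ → ℝ} {d₀ : ℝ} (hf : IsRegularizingFilter f d₀)
    {α : ℝ} (hα : 0 < α) (h : L2B d) (n : ℕ) :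
    ⟪ζ n, regularize ζ μ f α h⟫_ℂ = ((f α (μ n ^ 2) * μ n : ℝ) : ℂ) * ⟪ζ n, h⟫_ℂ := by
  obtain ⟨M, hM⟩ := hf.exists_multiplier_bound hN.antitone hN.pos hα
  obtain ⟨x, hx, hx'⟩ := hasSum_multiplier ζ hM h
  have : regularize ζ μ f α h = x := hx.tsum_eq
  rw [this, hx']

/-- Convergence of the energy `⟨R_α φ, N R_α φ⟩` to `‖g‖²` when `φ = N^{1/2} g`. -/
theorem tendsto_inner_regularize {N : L2B d →L[ℂ] L2B d} (hpos : N.IsPositive)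
    {ζ : HilbertBasis ℕ ℂ (L2B d)} {μ : ℕ → ℝ} (hN : IsEigensystem N ζ μ) {f : ℝ → ℝ → ℝ} {d₀ : ℝ}
    (hf : IsRegularizingFilter f d₀) {φ g : L2B d} (hg : opSqrt N g = φ) :
    Tendsto (fun α => ⟪N (regularize ζ μ f α φ), regularize ζ μ f α φ⟫_ℂ) (𝓝[>] 0)
      (𝓝 ((‖g‖ ^ 2 : ℝ) : ℂ)) := by
  have hφ : ∀ n, ⟪ζ n, φ⟫_ℂ = (Real.sqrt (μ n) : ℂ) * ⟪ζ n, g⟫_ℂ := fun n => by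
    rw [← hg]
    have h1 := (isPositive_opSqrt N).isSymmetric (ζ n) g
    refine h1.symm.trans ?_
    have h2 := opSqrt_apply_eigenvector hpos (hN.pos n) (hN.eigen n)
    rw [ContinuousLinearMap.coe_coe, h2, inner_smul_left, Complex.conj_ofReal]
  -- The factor `μ (f μ)²` from the energy meets `√μ · √μ = μ` from the two coefficients of `φ`,
  -- giving `(μ² f)²`.
  have hterm : ∀ α, 0 < α → ∀ n,
      ⟪N (regularize ζ μ f α φ), ζ n⟫_ℂ * ⟪ζ n, regularize ζ μ f α φ⟫_ℂ =
        (((μ n ^ 2 * f α (μ n ^ 2)) ^ 2 : ℝ) : ℂ) * (⟪g, ζ n⟫_ℂ * ⟪ζ n, g⟫_ℂ) := by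
    intro α hα n
    have h1 : ⟪N (regularize ζ μ f α φ), ζ n⟫_ℂ = μ n * ⟪regularize ζ μ f α φ, ζ n⟫_ℂ := by
      refine (hpos.isSymmetric _ _).trans ?_
      rw [ContinuousLinearMap.coe_coe, hN.eigen, inner_smul_right]
    rw [h1, ← inner_conj_symm (regularize ζ μ f α φ), inner_regularize hN hf hα, hφ, map_mul,
      map_mul, Complex.conj_ofReal, Complex.conj_ofReal, inner_conj_symm]
    have h2 : (Real.sqrt (μ n) : ℂ) * Real.sqrt (μ n) = μ n := by
      rw [← Complex.ofReal_mul, Real.mul_self_sqrt (hN.pos n).le]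
    push_cast
    linear_combination ((μ n : ℂ) * (f α (μ n ^ 2) * μ n) ^ 2 * (⟪g, ζ n⟫_ℂ * ⟪ζ n, g⟫_ℂ)) * h2
  have hnorm : ∑' n, ⟪g, ζ n⟫_ℂ * ⟪ζ n, g⟫_ℂ = ((‖g‖ ^ 2 : ℝ) : ℂ) := by
    rw [ζ.tsum_inner_mul_inner, inner_self_eq_norm_sq_to_K]
    push_cast
    rfl
  rw [← hnorm]
  have key : Tendsto (fun α => ∑' n, (((μ n ^ 2 * f α (μ n ^ 2)) ^ 2 : ℝ) : ℂ) *
      (⟪g, ζ n⟫_ℂ * ⟪ζ n, g⟫_ℂ)) (𝓝[>] 0) (𝓝 (∑' n, ⟪g, ζ n⟫_ℂ * ⟪ζ n, g⟫_ℂ)) := by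
    refine tendsto_tsum_of_dominated_convergence
      (bound := fun n => d₀ ^ 2 * ‖⟪g, ζ n⟫_ℂ * ⟪ζ n, g⟫_ℂ‖)
      ((ζ.summable_inner_mul_inner g g).norm.mul_left _) (fun n => ?_) ?_
    · have h0 := pow_pos (hN.pos n) 2
      have h1 := ((hf.tendsto _ h0).const_mul (μ n ^ 2)).pow 2
      rw [mul_one_div_cancel h0.ne', one_pow] at h1
      have h2 := ((Complex.continuous_ofReal.tendsto _).comp h1).mul_const
        (⟪g, ζ n⟫_ℂ * ⟪ζ n, g⟫_ℂ)
      simpa using h2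
    · filter_upwards [self_mem_nhdsWithin] with α hα n
      rw [norm_mul, Complex.norm_real, norm_pow, Real.norm_eq_abs]
      have := hf.bound α hα _ (pow_pos (hN.pos n) 2)
      gcongr
  refine key.congr' ?_
  filter_upwards [self_mem_nhdsWithin] with α hα
  rw [← ζ.tsum_inner_mul_inner]
  exact tsum_congr fun n => (hterm α hα n).symm

end Regularization

/-! ### Infinite dimension of `L²(B)` -/

section InfiniteDimensional

/-- Indicators of the disjoint open shells `1/(n+2) < ‖x‖ < 1/(n+1)` are nonzero and orthogonal. For
`d ≠ 0` every radius is attained, so the shells are nonempty. -/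
theorem not_finiteDimensional_L2B {d : ℕ} (hd : d ≠ 0) : ¬ FiniteDimensional ℂ (L2B d) := by
  intro hfin
  have : Nonempty (Fin d) := Fin.pos_iff_nonempty.1 (Nat.pos_of_ne_zero hd)
  have : Nontrivial (Rd d) := inferInstance
  let S : ℕ → Set (Rd d) := fun n =>
    Metric.ball 0 (1 / ((n : ℝ) + 1)) \ Metric.closedBall 0 (1 / ((n : ℝ) + 2))
  have hlt : ∀ n : ℕ, 1 / ((n : ℝ) + 2) < 1 / ((n : ℝ) + 1) := fun n =>
    one_div_lt_one_div_of_lt (by positivity) (by linarith)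
  have hSo : ∀ n, IsOpen (S n) := fun n => Metric.isOpen_ball.sdiff Metric.isClosed_closedBall
  have hSne : ∀ n, (S n).Nonempty := fun n => by
    obtain ⟨r, hr1, hr2⟩ := exists_between (hlt n)
    have hr0 : 0 ≤ r := (by positivity : (0 : ℝ) ≤ 1 / ((n : ℝ) + 2)).trans hr1.le
    obtain ⟨x, hx⟩ := exists_norm_eq (Rd d) hr0
    exact ⟨x, by simpa [S, hx] using ⟨by simpa using hr2, by simpa using hr1⟩⟩
  have hSB : ∀ n, S n ⊆ unitB d := fun n => Set.sdiff_subset.trans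
    (Metric.ball_subset_ball (by rw [div_le_one (by positivity)]; linarith [n.cast_nonneg (α := ℝ)]))
  have hSm : ∀ n, MeasurableSet (S n) := fun n => (hSo n).measurableSet
  have hSpos : ∀ n, (measB d).real (S n) ≠ 0 := fun n => by
    rw [Measure.real, Measure.restrict_apply (hSm n), Set.inter_eq_left.2 (hSB n)]
    exact (ENNReal.toReal_pos ((hSo n).measure_pos volume (hSne n)).ne'
      ((measure_mono (hSB n)).trans_lt measure_ball_lt_top).ne).ne'
  have hdisj : ∀ m n, m < n → S m ∩ S n = ∅ := fun m n hmn => by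
    refine Set.eq_empty_iff_forall_notMem.2 fun x hx => ?_
    have h1 : 1 / ((m : ℝ) + 2) < ‖x‖ := by simpa using hx.1.2
    have h2 : ‖x‖ < 1 / ((n : ℝ) + 1) := by simpa using hx.2.1
    have h3 : 1 / ((n : ℝ) + 1) ≤ 1 / ((m : ℝ) + 2) := by
      have : (m : ℝ) + 1 ≤ n := by exact_mod_cast hmn
      exact one_div_le_one_div_of_le (by positivity) (by linarith)
    linarith
  let v : ℕ → L2B d := fun n => indicatorConstLp 2 (hSm n) (measure_ne_top _ _) (1 : ℂ)
  have hv : ∀ m n, ⟪v m, v n⟫_ℂ = (measB d).real (S m ∩ S n) := fun m n =>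
    L2.inner_indicatorConstLp_one_indicatorConstLp_one (hSm m) (hSm n) _ _
  have hli : LinearIndependent ℂ v := by
    refine linearIndependent_of_ne_zero_of_inner_eq_zero (fun n h0 => ?_) fun m n hmn => ?_
    · have h1 := hv n n
      rw [h0, inner_zero_left, Set.inter_self] at h1
      exact hSpos n (by exact_mod_cast h1.symm)
    · refine (hv m n).trans ?_
      rcases lt_or_gt_of_ne hmn with h | h
      · rw [hdisj m n h]; simp
      · rw [Set.inter_comm, hdisj n m h]; simp
  have := hli.finite
  exact not_finite ℕ

end InfiniteDimensional

/-! ### Compactness of integral operators -/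

section Kernel

variable {d : ℕ}

theorem coeFn_kernelOp {K : Rd d → Rd d → ℂ} (hK : Continuous (Function.uncurry K)) {C : ℝ}
    (hC : ∀ t s, ‖K t s‖ ≤ C) (g : L2B d) :
    kernelOp K hK C hC g =ᵐ[measB d] fun t => ∫ s, K t s * g s ∂(measB d) :=
  (memLp_kernelInt hK hC g).coeFn_toLp

/-- The conjugate of a kernel section, as a vector of `L²(B)`. -/
theorem exists_inner_eq_kernelInt {K : Rd d → Rd d → ℂ} (hK : Continuous (Function.uncurry K))
    {C : ℝ} (hC : ∀ t s, ‖K t s‖ ≤ C) (t : Rd d) :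
    ∃ k : L2B d, ∀ g : L2B d, ⟪k, g⟫_ℂ = ∫ s, K t s * g s ∂(measB d) := by
  have hmem : MemLp (fun s => (starRingEnd ℂ) (K t s)) 2 (measB d) := by
    refine MemLp.of_bound (C := C) ?_ (Eventually.of_forall fun s => ?_)
    · exact (Complex.continuous_conj.comp
        (hK.comp (by fun_prop : Continuous fun s => (t, s)))).aestronglyMeasurable
    · rw [RCLike.norm_conj]; exact hC t s
  refine ⟨hmem.toLp, fun g => ?_⟩
  rw [L2.inner_def]
  refine integral_congr_ae ?_
  filter_upwards [hmem.coeFn_toLp] with s hs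
  rw [hs, RCLike.inner_apply, Complex.conj_conj, mul_comm]

/-- Integral operators with bounded continuous kernel on `L²(B)` are compact. -/
theorem isCompactOperator_kernelOp {K : Rd d → Rd d → ℂ} (hK : Continuous (Function.uncurry K))
    {C : ℝ} (hC : ∀ t s, ‖K t s‖ ≤ C) : IsCompactOperator (kernelOp K hK C hC) := by
  set T := kernelOp K hK C hC
  set m := (measB d).real Set.univ ^ (1 / 2 : ℝ) with hm
  have hm0 : 0 ≤ m := by positivity
  suffices h : T ∈ closure {f : L2B d →L[ℂ] L2B d | IsCompactOperator f} by
    rw [IsClosed.closure_eq isClosed_setOfPred_isCompactOperator] at h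
    exact h
  rw [Metric.mem_closure_iff]
  intro ε hε
  -- One `m` comes from bounding the `L²` norm by the sup norm, the other from bounding the `L¹`
  -- norm by the `L²` norm.
  obtain ⟨η, hη, hηε⟩ : ∃ η : ℝ, 0 < η ∧ m * (η * m) < ε := by
    refine ⟨ε / (m * m + 1), by positivity, ?_⟩
    rw [show m * (ε / (m * m + 1) * m) = ε * ((m * m) / (m * m + 1)) by ring]
    exact mul_lt_of_lt_one_right hε ((div_lt_one (by positivity)).2 (by linarith))
  have hcomp := isCompact_closedBall (0 : Rd d) 1
  have huc := (hcomp.prod hcomp).uniformContinuousOn_of_continuous hK.continuousOn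
  rw [Metric.uniformContinuousOn_iff] at huc
  obtain ⟨δ, hδ, hclose⟩ := huc η hη
  obtain ⟨F, hFB, hFfin, hFcover⟩ := finite_cover_balls_of_compact hcomp hδ
  choose k hk using fun t => exists_inner_eq_kernelInt hK hC t
  -- For `w ⊥ V` the function `T w` vanishes on the `δ`-net `F`, so uniform continuity of `K` makes
  -- it small on all of `B`. Hence `T` is within `ε` of the finite-rank operator `T ∘ P_V`.
  let V := Submodule.span ℂ (k '' F)
  have : FiniteDimensional ℂ V := FiniteDimensional.span_of_finite ℂ (hFfin.image k)
  refine ⟨T ∘L V.starProjection, ?_, ?_⟩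
  · have h1 : IsCompactOperator (id : V → V) :=
      (isCompactOperator_id_iff_finiteDimensional (𝕜 := ℂ)).2 this
    exact (h1.comp_clm V.orthogonalProjectionOnto).clm_comp (T ∘L V.subtypeL)
  rw [dist_eq_norm]
  refine (ContinuousLinearMap.opNorm_le_bound _ (by positivity) fun g => ?_).trans_lt hηε
  set w := g - V.starProjection g with hw
  have hTw : (T - T ∘L V.starProjection) g = T w := by
    rw [hw, map_sub]; rfl
  have hwg : ‖w‖ ≤ ‖g‖ := by
    rw [hw, ← Submodule.starProjection_orthogonal_val]
    exact Submodule.norm_starProjection_apply_le _ _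
  have hwF : ∀ t ∈ F, ∫ s, K t s * w s ∂(measB d) = 0 := fun t ht => by
    have h0 : ⟪w, k t⟫_ℂ = 0 := Submodule.starProjection_inner_eq_zero g _
      (Submodule.subset_span (Set.mem_image_of_mem k ht))
    rw [← hk, ← inner_conj_symm, h0, map_zero]
  rw [hTw]
  have hbound : ∀ t ∈ unitB d, ‖∫ s, K t s * w s ∂(measB d)‖ ≤ η * (m * ‖g‖) := by
    intro t ht
    have htB := Metric.ball_subset_closedBall ht
    obtain ⟨t', ht', htt'⟩ := Set.mem_iUnion₂.1 (hFcover htB)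
    rw [← sub_zero (∫ s, K t s * w s ∂(measB d)), ← hwF t' ht',
      ← integral_sub (integrable_kernel_mul hK hC w t) (integrable_kernel_mul hK hC w t')]
    have hwi : Integrable (fun s => w s) (measB d) := (Lp.memLp w).integrable (by norm_num)
    refine (norm_integral_le_of_norm_le (hwi.norm.const_mul η) ?_).trans ?_
    · filter_upwards [ae_restrict_mem measurableSet_ball] with s hs
      rw [← sub_mul, norm_mul]
      refine mul_le_mul_of_nonneg_right ?_ (norm_nonneg _)
      have hsB := Metric.ball_subset_closedBall hs
      have h1 := hclose (t, s) ⟨htB, hsB⟩ (t', s) ⟨hFB ht', hsB⟩ (by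
        rw [Prod.dist_eq, dist_self]
        exact max_lt htt' hδ)
      rw [dist_eq_norm] at h1
      exact h1.le
    · rw [integral_const_mul]
      exact mul_le_mul_of_nonneg_left
        ((integral_norm_le w).trans (mul_le_mul_of_nonneg_left hwg hm0)) hη.le
  have h := Lp.norm_le_of_ae_bound (p := 2) (f := T w) (C := η * (m * ‖g‖)) (by positivity) (by
    filter_upwards [coeFn_kernelOp hK hC w, ae_restrict_mem measurableSet_ball] with t ht htB
    rw [ht]
    exact hbound t htB)
  refine h.trans (le_of_eq ?_)
  have e : (measB d).real Set.univ ^ ((2 : ENNReal).toReal)⁻¹ = m := by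
    rw [hm]; norm_num
  have e2 : (measureUnivNNReal (measB d) : ℝ) = (measB d).real Set.univ := rfl
  rw [e2, e]
  ring

end Kernel

/-! ### Truncated Fourier operators and the factorization of `N` -/

section Fourier

variable {d : ℕ}

/-- The kernel `exp (i a x·y)`. -/
noncomputable def osc (a : ℝ) (x y : Rd d) : ℂ :=
  Complex.exp (Complex.I * ((a * inner ℝ x y : ℝ) : ℂ))

theorem norm_osc (a : ℝ) (x y : Rd d) : ‖osc a x y‖ = 1 := by
  rw [osc, mul_comm, Complex.norm_exp_ofReal_mul_I]

theorem continuous_osc (a : ℝ) : Continuous (Function.uncurry (osc a : Rd d → Rd d → ℂ)) := by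
  unfold osc Function.uncurry
  fun_prop

theorem conj_osc (a : ℝ) (x y : Rd d) : (starRingEnd ℂ) (osc a x y) = osc (-a) y x := by
  rw [osc, osc, ← Complex.exp_conj, map_mul, Complex.conj_I, Complex.conj_ofReal, real_inner_comm]
  push_cast
  ring_nf

/-- The truncated Fourier operator `(F g)(t) = ∫_B exp (i a t·s) g(s) ds` on `L²(B)`. -/
noncomputable def fourierOp (d : ℕ) (a : ℝ) : L2B d →L[ℂ] L2B d :=
  kernelOp (osc a) (continuous_osc a) 1 fun t s => (norm_osc a t s).le

theorem coeFn_fourierOp (a : ℝ) (g : L2B d) :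
    fourierOp d a g =ᵐ[measB d] fun t => ∫ s, osc a t s * g s ∂(measB d) :=
  coeFn_kernelOp _ _ g

theorem continuous_fourierInt (a : ℝ) (g : L2B d) :
    Continuous fun t => ∫ s, osc a t s * g s ∂(measB d) := by
  have hg : Integrable (fun s => g s) (measB d) := (Lp.memLp g).integrable (by norm_num)
  refine continuous_of_dominated (bound := fun s => ‖g s‖)
    (fun t => (integrable_kernel_mul (continuous_osc a) (C := 1)
      (fun t s => (norm_osc a t s).le) g t).aestronglyMeasurable)
    (fun t => Eventually.of_forall fun s => by rw [norm_mul, norm_osc, one_mul]) hg.norm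
    (Eventually.of_forall fun s => ?_)
  exact ((continuous_osc a).comp (by fun_prop : Continuous fun t => (t, s))).mul continuous_const

/-- Fubini, with the conjugate-transposed kernel of `osc a` being `osc (-a)`. -/
theorem inner_fourierOp_left (a : ℝ) (f g : L2B d) :
    ⟪fourierOp d a f, g⟫_ℂ = ⟪f, fourierOp d (-a) g⟫_ℂ := by
  have hf : Integrable (fun s => f s) (measB d) := (Lp.memLp f).integrable (by norm_num)
  have hg : Integrable (fun s => g s) (measB d) := (Lp.memLp g).integrable (by norm_num)
  rw [L2.inner_def, L2.inner_def]
  have h1 : ∫ t, ⟪fourierOp d a f t, g t⟫_ℂ ∂(measB d) =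
      ∫ t, ∫ s, osc (-a) s t * (g t * (starRingEnd ℂ) (f s)) ∂(measB d) ∂(measB d) := by
    refine integral_congr_ae ?_
    filter_upwards [coeFn_fourierOp a f] with t ht
    rw [RCLike.inner_apply, ht, ← integral_conj, ← integral_const_mul]
    refine integral_congr_ae (Eventually.of_forall fun s => ?_)
    simp only [map_mul, conj_osc]
    ring
  have h2 : ∫ s, ⟪f s, fourierOp d (-a) g s⟫_ℂ ∂(measB d) =
      ∫ s, ∫ t, osc (-a) s t * (g t * (starRingEnd ℂ) (f s)) ∂(measB d) ∂(measB d) := by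
    refine integral_congr_ae ?_
    filter_upwards [coeFn_fourierOp (-a) g] with s hs
    rw [RCLike.inner_apply, hs, ← integral_mul_const]
    refine integral_congr_ae (Eventually.of_forall fun t => ?_)
    ring
  rw [h1, h2]
  refine integral_integral_swap ?_
  have h3 : Integrable (fun p : Rd d × Rd d => g p.1 * (starRingEnd ℂ) (f p.2))
      ((measB d).prod (measB d)) :=
    hg.mul_prod (RCLike.conjCLE.toContinuousLinearMap.integrable_comp hf)
  refine h3.bdd_mul (c := 1) ?_ (Eventually.of_forall fun p => (norm_osc _ _ _).le)
  exact ((continuous_osc (-a)).comp continuous_swap).aestronglyMeasurable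

/-- Multiplication by an essentially bounded real function on `L²(B)`. -/
noncomputable def mulOp {w : Rd d → ℝ} (hw : MemLp (fun y => (w y : ℂ)) ⊤ (measB d)) :
    L2B d →L[ℂ] L2B d :=
  ContinuousLinearMap.holderL (measB d) ⊤ 2 2 (ContinuousLinearMap.mul ℂ ℂ) hw.toLp

theorem coeFn_mulOp {w : Rd d → ℝ} (hw : MemLp (fun y => (w y : ℂ)) ⊤ (measB d)) (g : L2B d) :
    mulOp hw g =ᵐ[measB d] fun y => (w y : ℂ) * g y := by
  have h := ContinuousLinearMap.coeFn_holder (r := 2) (ContinuousLinearMap.mul ℂ ℂ) hw.toLp g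
  filter_upwards [h, hw.coeFn_toLp] with y hy hwy
  refine hy.trans ?_
  rw [hwy]
  rfl

theorem inner_mulOp_left {w : Rd d → ℝ} (hw : MemLp (fun y => (w y : ℂ)) ⊤ (measB d))
    (f g : L2B d) : ⟪mulOp hw f, g⟫_ℂ = ⟪f, mulOp hw g⟫_ℂ := by
  rw [L2.inner_def, L2.inner_def]
  refine integral_congr_ae ?_
  filter_upwards [coeFn_mulOp hw f, coeFn_mulOp hw g] with y hf hg
  rw [hf, hg, RCLike.inner_apply, RCLike.inner_apply, map_mul, Complex.conj_ofReal]
  ring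

theorem adjoint_mulOp_comp_fourierOp {w : Rd d → ℝ}
    (hw : MemLp (fun y => (w y : ℂ)) ⊤ (measB d)) (a : ℝ) :
    (mulOp hw ∘L fourierOp d (-a)).adjoint = fourierOp d a ∘L mulOp hw := by
  refine ((ContinuousLinearMap.eq_adjoint_iff _ _).2 fun x y => ?_).symm
  rw [ContinuousLinearMap.comp_apply, ContinuousLinearMap.comp_apply, inner_fourierOp_left,
    inner_mulOp_left]

/-- The factorization of the data operator through the truncated Fourier operators. -/
theorem dataOp_eq (c : ℝ) {q : Rd d → ℝ} (hq : MemLp (fun y => (q y : ℂ)) ⊤ (measB d))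
    (g : L2B d) : dataOp c q g = fourierOp d c (mulOp hq (fourierOp d (-c) g)) := by
  have hg : Integrable (fun s => g s) (measB d) := (Lp.memLp g).integrable (by norm_num)
  have hqi : Integrable (fun y => (q y : ℂ)) (measB d) := hq.integrable le_top
  refine Lp.ext ?_
  filter_upwards [coeFn_kernelOp _ _ g, coeFn_fourierOp c (mulOp hq (fourierOp d (-c) g))]
    with t h1 h2
  refine h1.trans (Eq.trans ?_ h2.symm)
  have h3 : ∫ y, osc c t y * mulOp hq (fourierOp d (-c) g) y ∂(measB d) =
      ∫ y, ∫ s, osc c t y * osc (-c) y s * ((q y : ℂ) * g s) ∂(measB d) ∂(measB d) := by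
    refine integral_congr_ae ?_
    filter_upwards [coeFn_mulOp hq (fourierOp d (-c) g), coeFn_fourierOp (-c) g] with y hy hy'
    rw [hy, hy', ← mul_assoc, ← integral_const_mul]
    refine integral_congr_ae (Eventually.of_forall fun s => ?_)
    ring
  have h4 : ∫ s, data c q ((2 : ℝ)⁻¹ • (t - s)) * g s ∂(measB d) =
      ∫ s, ∫ y, osc c t y * osc (-c) y s * ((q y : ℂ) * g s) ∂(measB d) ∂(measB d) := by
    refine integral_congr_ae (Eventually.of_forall fun s => ?_)
    simp only [data, oscInt]
    rw [← integral_mul_const]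
    refine integral_congr_ae (Eventually.of_forall fun y => ?_)
    simp only [osc]
    -- The phases agree: `2c ((t - s)/2)·y = c t·y - c y·s`.
    rw [← Complex.exp_add, ← mul_add, ← Complex.ofReal_add, mul_assoc]
    congr 4
    rw [real_inner_smul_left, inner_sub_left, real_inner_comm s y]
    ring
  rw [h3, h4]
  refine integral_integral_swap ?_
  have h5 : Integrable (fun p : Rd d × Rd d => (q p.2 : ℂ) * g p.1)
      ((measB d).prod (measB d)) :=
    (hg.mul_prod hqi).congr (Eventually.of_forall fun p => mul_comm _ _)
  refine h5.bdd_mul (c := 1) ?_ (Eventually.of_forall fun p => ?_)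
  · exact (((continuous_osc c).comp (by fun_prop : Continuous fun p : Rd d × Rd d => (t, p.2))).mul
      ((continuous_osc (-c)).comp continuous_swap)).aestronglyMeasurable
  · rw [norm_mul, norm_osc, norm_osc, one_mul]

end Fourier

/-! ### Injectivity of the truncated Fourier transform -/

section Injectivity

variable {d : ℕ}

/-- The Fourier integral of an `L²(B)` function extends to an entire function along each line. -/
theorem differentiable_fourierInt_line (a : ℝ) (g : L2B d) (y v : Rd d) :
    Differentiable ℂ fun z : ℂ => ∫ s, Complex.exp (Complex.I * (a * (inner ℝ y s : ℝ)) +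
      z * (Complex.I * (a * (inner ℝ v s : ℝ)))) * g s ∂(measB d) := by
  intro z₀
  have hg : Integrable (fun s => g s) (measB d) := (Lp.memLp g).integrable (by norm_num)
  set F : ℂ → Rd d → ℂ := fun z s => Complex.exp (Complex.I * (a * (inner ℝ y s : ℝ)) +
      z * (Complex.I * (a * (inner ℝ v s : ℝ)))) * g s with hF
  set F' : ℂ → Rd d → ℂ := fun z s => (Complex.exp (Complex.I * (a * (inner ℝ y s : ℝ)) +
      z * (Complex.I * (a * (inner ℝ v s : ℝ)))) * (Complex.I * (a * (inner ℝ v s : ℝ)))) * g s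
    with hF'
  -- Boundedness of `B` keeps the exponential bounded for complex `z` near `z₀`, which permits
  -- differentiation under the integral.
  have hinner : ∀ s ∈ unitB d, |inner ℝ v s| ≤ ‖v‖ := fun s hs => by
    have h1 : ‖s‖ ≤ 1 := by simpa using (Metric.mem_ball.1 hs).le
    exact (abs_real_inner_le_norm v s).trans (mul_le_of_le_one_right (norm_nonneg v) h1)
  have hexp : ∀ s ∈ unitB d, ∀ z ∈ Metric.ball z₀ 1,
      ‖Complex.exp (Complex.I * (a * (inner ℝ y s : ℝ)) +
        z * (Complex.I * (a * (inner ℝ v s : ℝ))))‖ ≤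
        Real.exp ((‖z₀‖ + 1) * (|a| * ‖v‖)) := fun s hs z hz => by
    rw [Complex.norm_exp]
    refine Real.exp_le_exp.2 ?_
    have h1 : (Complex.I * (a * (inner ℝ y s : ℝ)) +
        z * (Complex.I * (a * (inner ℝ v s : ℝ)))).re = -z.im * (a * inner ℝ v s) := by
      simp [← Complex.ofReal_mul]
    rw [h1]
    refine (le_abs_self _).trans ?_
    rw [abs_mul, abs_mul, abs_neg]
    have h2 : |z.im| ≤ ‖z₀‖ + 1 := by
      have h3 := norm_sub_norm_le z z₀
      have h4 := mem_ball_iff_norm.1 hz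
      linarith [Complex.abs_im_le_norm z]
    exact mul_le_mul h2 (mul_le_mul_of_nonneg_left (hinner s hs) (abs_nonneg a)) (by positivity)
      (by positivity)
  have hmeas : ∀ z, AEStronglyMeasurable (F z) (measB d) := fun z =>
    (Continuous.aestronglyMeasurable (by fun_prop)).mul hg.aestronglyMeasurable
  have hder := hasDerivAt_integral_of_dominated_loc_of_deriv_le (μ := measB d) (F := F) (F' := F')
    (bound := fun s => Real.exp ((‖z₀‖ + 1) * (|a| * ‖v‖)) * (|a| * ‖v‖) * ‖g s‖)
    (Metric.ball_mem_nhds z₀ one_pos) (Eventually.of_forall hmeas) ?_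
    ((Continuous.aestronglyMeasurable (by fun_prop)).mul hg.aestronglyMeasurable) ?_
    (hg.norm.const_mul _) ?_
  · exact hder.2.differentiableAt
  · refine (hg.norm.const_mul (Real.exp ((‖z₀‖ + 1) * (|a| * ‖v‖)))).mono' (hmeas z₀) ?_
    filter_upwards [ae_restrict_mem measurableSet_ball] with s hs
    rw [hF, norm_mul]
    exact mul_le_mul_of_nonneg_right (hexp s hs z₀ (Metric.mem_ball_self one_pos)) (norm_nonneg _)
  · filter_upwards [ae_restrict_mem measurableSet_ball] with s hs z hz
    rw [hF', norm_mul, norm_mul]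
    refine mul_le_mul_of_nonneg_right ?_ (norm_nonneg _)
    refine mul_le_mul (hexp s hs z hz) ?_ (norm_nonneg _) (Real.exp_pos _).le
    rw [norm_mul, norm_mul, Complex.norm_I, one_mul, Complex.norm_real, Complex.norm_real,
      Real.norm_eq_abs, Real.norm_eq_abs]
    exact mul_le_mul_of_nonneg_left (hinner s hs) (abs_nonneg a)
  · refine Eventually.of_forall fun s z _ => ?_
    have h1 : HasDerivAt (fun z : ℂ => Complex.I * (a * (inner ℝ y s : ℝ)) +
        z * (Complex.I * (a * (inner ℝ v s : ℝ)))) (Complex.I * (a * (inner ℝ v s : ℝ))) z := by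
      simpa using ((hasDerivAt_id z).mul_const
        (Complex.I * (a * ((inner ℝ v s : ℝ) : ℂ)))).const_add (Complex.I * (a * (inner ℝ y s : ℝ)))
    exact h1.cexp.mul_const (g s)

/-- A Fourier integral of an `L²(B)` function that vanishes on a nonempty open set vanishes
everywhere. -/
theorem fourierInt_eq_zero (a : ℝ) (g : L2B d) {U : Set (Rd d)} (hU : IsOpen U)
    (hne : U.Nonempty) (h : ∀ y ∈ U, ∫ s, osc a y s * g s ∂(measB d) = 0) (x : Rd d) :
    ∫ s, osc a x s * g s ∂(measB d) = 0 := by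
  obtain ⟨y, hy⟩ := hne
  -- The complexified line through `y ∈ U` and `x`: `Φ` vanishes at real points near 0, hence
  -- identically, and `Φ 1` is the value at `x`.
  set Φ : ℂ → ℂ := fun z => ∫ s, Complex.exp (Complex.I * (a * (inner ℝ y s : ℝ)) +
      z * (Complex.I * (a * (inner ℝ (x - y) s : ℝ)))) * g s ∂(measB d) with hΦ
  have hreal : ∀ r : ℝ, Φ r = ∫ s, osc a (y + r • (x - y)) s * g s ∂(measB d) := fun r => by
    refine integral_congr_ae (Eventually.of_forall fun s => ?_)
    simp only [osc]
    congr 2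
    rw [inner_add_left, real_inner_smul_left]
    push_cast
    ring
  have hΦd : Differentiable ℂ Φ := differentiable_fourierInt_line a g y (x - y)
  have hΦa : AnalyticOnNhd ℂ Φ Set.univ := fun z _ => hΦd.analyticAt z
  have hev : ∀ᶠ r : ℝ in 𝓝 0, Φ r = 0 := by
    have hc : ContinuousAt (fun r : ℝ => y + r • (x - y)) 0 := by fun_prop
    filter_upwards [hc (by simpa using hU.mem_nhds hy)] with r hr
    rw [hreal]
    exact h _ hr
  have hfreq : ∃ᶠ z in 𝓝[≠] (0 : ℂ), Φ z = 0 := by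
    have ht : Tendsto (fun r : ℝ => (r : ℂ)) (𝓝[≠] 0) (𝓝[≠] 0) := by
      refine tendsto_nhdsWithin_iff.2 ⟨?_, ?_⟩
      · have := Complex.continuous_ofReal.tendsto 0
        rw [Complex.ofReal_zero] at this
        exact this.mono_left nhdsWithin_le_nhds
      · filter_upwards [self_mem_nhdsWithin] with r hr
        simpa using hr
    exact ht.frequently (hev.filter_mono nhdsWithin_le_nhds).frequently
  have h0 := hΦa.eqOn_zero_of_preconnected_of_frequently_eq_zero isPreconnected_univ
    (Set.mem_univ 0) hfreq (Set.mem_univ 1)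
  have h1 := hreal 1
  rw [Complex.ofReal_one, h0] at h1
  simpa using h1.symm

/-- The Fourier integral is injective on `L²(B)`. -/
theorem eq_zero_of_fourierInt_eq_zero {a : ℝ} (ha : a ≠ 0) (g : L2B d)
    (h : ∀ x, ∫ s, osc a x s * g s ∂(measB d) = 0) : g = 0 := by
  have hg : Integrable (fun s => g s) (measB d) := (Lp.memLp g).integrable (by norm_num)
  set G : Rd d → ℂ := (unitB d).indicator fun s => g s with hG
  have hGi : Integrable G volume := (integrable_indicator_iff measurableSet_ball).2 hg
  have hFG : ∀ w, 𝓕 G w = 0 := fun w => by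
    rw [Real.fourier_eq']
    -- This rescaling turns the phase `a x·s` into Mathlib's `-2π s·w`.
    have h1 := h ((-2 * Real.pi / a) • w)
    rw [← h1, ← integral_indicator measurableSet_ball]
    refine integral_congr_ae (Eventually.of_forall fun s => ?_)
    simp only [hG]
    by_cases hs : s ∈ unitB d
    · rw [Set.indicator_of_mem hs, Set.indicator_of_mem hs, smul_eq_mul, osc]
      congr 2
      rw [real_inner_smul_left, ← mul_assoc, mul_div_cancel₀ _ ha, real_inner_comm, mul_comm]
    · rw [Set.indicator_of_notMem hs, Set.indicator_of_notMem hs, smul_zero]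
  have hG0 : ∀ᵐ s ∂volume, G s = 0 := by
    refine ae_eq_zero_of_integral_contDiff_smul_eq_zero hGi.locallyIntegrable fun φ hφ hφc => ?_
    have h1 : HasCompactSupport (Complex.ofRealCLM ∘ φ) := hφc.comp_left rfl
    have h2 : ContDiff ℝ ∞ (Complex.ofRealCLM ∘ φ) := by fun_prop
    -- Multiplication formula: `∫ φ G = ∫ 𝓕(𝓕⁻ ψ) G = ∫ (𝓕⁻ ψ) 𝓕 G = 0`, so inversion is needed only
    -- for Schwartz functions.
    set ψ := h1.toSchwartzMap h2 with hψ
    have h3 := VectorFourier.integral_fourierIntegral_smul_eq_flip (L := innerₗ (Rd d))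
      (f := (𝓕⁻ ψ : SchwartzMap (Rd d) ℂ)) (g := G) Real.continuous_fourierChar
      continuous_inner ((𝓕⁻ ψ : SchwartzMap (Rd d) ℂ).integrable (μ := volume)) hGi
    have h4 : ∀ w, VectorFourier.fourierIntegral Real.fourierChar volume (innerₗ (Rd d))
        (𝓕⁻ ψ : SchwartzMap (Rd d) ℂ) w = φ w := fun w => by
      have h5 : 𝓕 (𝓕⁻ ψ : SchwartzMap (Rd d) ℂ) = ψ := FourierTransform.fourier_fourierInv_eq ψ
      have h6 := congrArg (fun η : SchwartzMap (Rd d) ℂ => η w) h5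
      rw [SchwartzMap.fourier_coe] at h6
      exact h6
    have h5 : ∀ w, VectorFourier.fourierIntegral Real.fourierChar volume (innerₗ (Rd d)).flip
        G w = 0 := fun w => by
      rw [flip_innerₗ]
      exact hFG w
    simp only [h4, h5, smul_zero, integral_zero] at h3
    exact h3
  refine (Lp.eq_zero_iff_ae_eq_zero).2 ?_
  filter_upwards [ae_restrict_of_ae hG0, ae_restrict_mem measurableSet_ball] with s hs hsB
  rwa [hG, Set.indicator_of_mem hsB] at hs

/-- A function in `L²(B)` whose truncated Fourier transform vanishes almost everywhere on a nonempty
open subset of `B` is zero. -/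
theorem eq_zero_of_fourierOp_ae_eq_zero {a : ℝ} (ha : a ≠ 0) (g : L2B d) {U : Set (Rd d)}
    (hU : IsOpen U) (hUB : U ⊆ unitB d) (hne : U.Nonempty)
    (h : ∀ᵐ y ∂(measB d), y ∈ U → fourierOp d a g y = 0) : g = 0 := by
  refine eq_zero_of_fourierInt_eq_zero ha g (fourierInt_eq_zero a g hU hne fun y hy => ?_)
  have h1 : (fun t => ∫ s, osc a t s * g s ∂(measB d)) =ᵐ[volume.restrict U] fun _ => 0 := by
    have h2 : ∀ᵐ y ∂(measB d), y ∈ U → ∫ s, osc a y s * g s ∂(measB d) = 0 := by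
      filter_upwards [h, coeFn_fourierOp a g] with y hy hy' hyU
      rw [← hy', hy hyU]
    filter_upwards [ae_restrict_of_ae_restrict_of_subset hUB h2,
      ae_restrict_mem hU.measurableSet] with y hy hyU using hy hyU
  exact Measure.eqOn_open_of_ae_eq h1 hU (continuous_fourierInt a g).continuousOn
    continuousOn_const hy

end Injectivity

/-! ### The operator `A` and the vector `h` -/

section Factorization

variable {d : ℕ}

theorem memLp_normInd_mul {R : Set (Rd d)} (hR : MeasurableSet R) {w : Rd d → ℝ}
    (hw : AEMeasurable w (measB d)) {C : ℝ} (hC : ∀ᵐ y ∂(measB d), y ∈ R → |w y| ≤ C) :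
    MemLp (fun y => ((normInd R y * w y : ℝ) : ℂ)) 2 (measB d) := by
  refine MemLp.of_bound (C := (volume.real R)⁻¹ * |C|) ?_ ?_
  · have h1 : AEMeasurable (normInd R) (measB d) :=
      ((measurable_const.indicator hR).const_mul _).aemeasurable
    exact (Complex.measurable_ofReal.comp_aemeasurable (h1.mul hw)).aestronglyMeasurable
  · filter_upwards [hC] with y hy
    rw [Complex.norm_real, Real.norm_eq_abs, abs_mul, normInd]
    by_cases hyR : y ∈ R
    · rw [Set.indicator_of_mem hyR, mul_one, abs_of_nonneg (by positivity)]
      exact mul_le_mul_of_nonneg_left ((hy hyR).trans (le_abs_self C)) (by positivity)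
    · rw [Set.indicator_of_notMem hyR, mul_zero, abs_zero, zero_mul]
      positivity

theorem normInd_of_notMem {R : Set (Rd d)} {y : Rd d} (hy : y ∉ R) : normInd R y = 0 := by
  rw [normInd, Set.indicator_of_notMem hy, mul_zero]

theorem normInd_of_mem {R : Set (Rd d)} {y : Rd d} (hy : y ∈ R) :
    normInd R y = (volume.real R)⁻¹ := by
  rw [normInd, Set.indicator_of_mem hy, mul_one]

/-- The test function is the truncated Fourier transform of the normalized indicator. -/
theorem testFun_eq {c : ℝ} {R : Set (Rd d)} (hRB : R ⊆ unitB d) {e : L2B d}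
    (he : e =ᵐ[measB d] fun y => (normInd R y : ℂ)) : testFun c R = fourierOp d c e := by
  refine Lp.ext ?_
  filter_upwards [MemLp.coeFn_toLp (MemLp.of_bound (μ := measB d) (p := 2)
      (continuous_oscInt volume c (normInd R)).aestronglyMeasurable
      (∫ y, ‖normInd R y‖) (Eventually.of_forall fun t => norm_oscInt_le _ _ _ t)),
    coeFn_fourierOp c e] with t h1 h2
  refine h1.trans (Eq.trans ?_ h2.symm)
  have h3 : ∫ s, osc c t s * e s ∂(measB d) = ∫ s, osc c t s * (normInd R s : ℂ) ∂(measB d) := by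
    refine integral_congr_ae ?_
    filter_upwards [he] with s hs
    rw [hs]
  rw [h3]
  refine (setIntegral_eq_integral_of_forall_compl_eq_zero fun y hy => ?_).symm
  rw [normInd_of_notMem fun h => hy (hRB h), Complex.ofReal_zero, mul_zero]

/-- The factorization `N = A† A`, `φ = A† h` with `A` injective, `h` orthogonal to the kernel of
`A†`, and `|R| ‖h‖² = ∫_R E / q`. -/
theorem exists_factorization {c : ℝ} (hc : c ≠ 0) {Ω : Set (Rd d)} (hΩ : IsOpen Ω)
    (hΩB : Ω ⊆ unitB d) {q : Rd d → ℝ} (hq_meas : AEMeasurable q volume)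
    (hq_supp : ∀ᵐ y ∂(volume.restrict Ωᶜ), q y = 0) {q_inf q_sup : ℝ} (hq_inf : 0 < q_inf)
    (hq : ∀ᵐ y ∂(volume.restrict Ω), q_inf ≤ q y ∧ q y ≤ q_sup)
    {R : Set (Rd d)} (hR_meas : MeasurableSet R) (hR_pos : 0 < volume R) (hRΩ : R ⊆ Ω) :
    ∃ (A : L2B d →L[ℂ] L2B d) (h : L2B d), dataOp c q = A.adjoint ∘L A ∧
      testFun c R = A.adjoint h ∧ (∀ g, A g = 0 → g = 0) ∧
      (∀ y, A.adjoint y = 0 → ⟪y, h⟫_ℂ = 0) ∧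
      IntegrableOn (fun y => 1 / q y * normInd R y) R volume ∧
      volume.real R * ‖h‖ ^ 2 = ∫ y in R, 1 / q y * normInd R y := by
  have hRB : R ⊆ unitB d := hRΩ.trans hΩB
  have hR_fin : volume R ≠ ⊤ := ((measure_mono hRB).trans_lt measure_ball_lt_top).ne
  have hRne : R.Nonempty := nonempty_of_measure_ne_zero hR_pos.ne'
  have hqm : AEMeasurable q (measB d) := hq_meas.restrict
  have hq_in : ∀ᵐ y ∂(measB d), y ∈ Ω → q_inf ≤ q y ∧ q y ≤ q_sup :=
    ae_restrict_of_ae ((ae_restrict_iff' hΩ.measurableSet).1 hq)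
  have hq_out : ∀ᵐ y ∂(measB d), y ∉ Ω → q y = 0 :=
    ae_restrict_of_ae ((ae_restrict_iff' hΩ.measurableSet.compl).1 hq_supp)
  have hq_abs : ∀ᵐ y ∂(measB d), 0 ≤ q y ∧ q y ≤ |q_sup| := by
    filter_upwards [hq_in, hq_out] with y h1 h2
    by_cases hy : y ∈ Ω
    · exact ⟨hq_inf.le.trans (h1 hy).1, (h1 hy).2.trans (le_abs_self _)⟩
    · rw [h2 hy]; exact ⟨le_rfl, abs_nonneg _⟩
  have hqL : MemLp (fun y => (q y : ℂ)) ⊤ (measB d) := by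
    refine memLp_top_of_bound (Complex.measurable_ofReal.comp_aemeasurable hqm).aestronglyMeasurable
      |q_sup| ?_
    filter_upwards [hq_abs] with y hy
    rw [Complex.norm_real, Real.norm_eq_abs, abs_of_nonneg hy.1]
    exact hy.2
  have hsm : AEMeasurable (fun y => Real.sqrt (q y)) (measB d) := hqm.sqrt
  have hsL : MemLp (fun y => ((Real.sqrt (q y) : ℝ) : ℂ)) ⊤ (measB d) := by
    refine memLp_top_of_bound (Complex.measurable_ofReal.comp_aemeasurable hsm).aestronglyMeasurable
      (Real.sqrt |q_sup|) ?_
    filter_upwards [hq_abs] with y hy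
    rw [Complex.norm_real, Real.norm_eq_abs, abs_of_nonneg (Real.sqrt_nonneg _)]
    exact Real.sqrt_le_sqrt hy.2
  -- This is `h = E / √q`. The lower bound on `q` is needed only on `R ⊆ Ω`, since `E` vanishes
  -- elsewhere.
  have hhL : MemLp (fun y => ((normInd R y * (Real.sqrt (q y))⁻¹ : ℝ) : ℂ)) 2 (measB d) := by
    refine memLp_normInd_mul hR_meas hsm.inv (C := (Real.sqrt q_inf)⁻¹) ?_
    filter_upwards [hq_in] with y hy hyR
    rw [abs_of_nonneg (inv_nonneg.2 (Real.sqrt_nonneg _))]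
    exact inv_anti₀ (Real.sqrt_pos.2 hq_inf) (Real.sqrt_le_sqrt (hy (hRΩ hyR)).1)
  have hA := adjoint_mulOp_comp_fourierOp hsL c
  refine ⟨mulOp hsL ∘L fourierOp d (-c), hhL.toLp, ?_, ?_, fun g hg => ?_, fun y hy => ?_, ?_, ?_⟩
  · refine ContinuousLinearMap.ext fun g => ?_
    rw [hA, dataOp_eq c hqL]
    simp only [ContinuousLinearMap.comp_apply]
    congr 1
    refine Lp.ext ?_
    filter_upwards [coeFn_mulOp hqL (fourierOp d (-c) g),
      coeFn_mulOp hsL (mulOp hsL (fourierOp d (-c) g)), coeFn_mulOp hsL (fourierOp d (-c) g),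
      hq_abs] with y h1 h2 h3 h4
    rw [h1, h2, h3, ← mul_assoc, ← Complex.ofReal_mul, Real.mul_self_sqrt h4.1]
  · rw [hA, ContinuousLinearMap.comp_apply]
    refine testFun_eq hRB ?_
    filter_upwards [coeFn_mulOp hsL hhL.toLp, hhL.coeFn_toLp, hq_in] with y h1 h2 h3
    rw [h1, h2, ← Complex.ofReal_mul]
    congr 1
    by_cases hyR : y ∈ R
    · have h4 : Real.sqrt (q y) ≠ 0 := (Real.sqrt_pos.2 (hq_inf.trans_le (h3 (hRΩ hyR)).1)).ne'
      rw [mul_left_comm, mul_inv_cancel₀ h4, mul_one]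
    · rw [normInd_of_notMem hyR, zero_mul, mul_zero]
  -- On `Ω` the factor `√q` is positive a.e. and can be cancelled; positive measure of `R` makes `Ω`
  -- nonempty.
  · refine eq_zero_of_fourierOp_ae_eq_zero (neg_ne_zero.2 hc) g hΩ hΩB (hRne.mono hRΩ) ?_
    have h0 := (Lp.eq_zero_iff_ae_eq_zero).1 hg
    filter_upwards [h0, coeFn_mulOp hsL (fourierOp d (-c) g), hq_in] with y h1 h2 h3 hyΩ
    have h4 : ((Real.sqrt (q y) : ℝ) : ℂ) ≠ 0 :=
      Complex.ofReal_ne_zero.2 (Real.sqrt_pos.2 (hq_inf.trans_le (h3 hyΩ).1)).ne'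
    have h5 := h2.symm.trans h1
    exact (mul_eq_zero.1 h5).resolve_left h4
  · rw [hA, ContinuousLinearMap.comp_apply] at hy
    -- Here the transform vanishes on the whole ball, so its argument `√q y` is zero; then `y = 0`
    -- a.e. on `R`, and `h = 0` off `R`.
    have h0 : mulOp hsL y = 0 := by
      refine eq_zero_of_fourierOp_ae_eq_zero hc _ Metric.isOpen_ball subset_rfl
        ⟨0, Metric.mem_ball_self one_pos⟩ ?_
      filter_upwards [(Lp.eq_zero_iff_ae_eq_zero).1 hy] with t ht _ using ht
    rw [L2.inner_def]
    refine integral_eq_zero_of_ae ?_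
    filter_upwards [(Lp.eq_zero_iff_ae_eq_zero).1 h0, coeFn_mulOp hsL y, hq_in,
      hhL.coeFn_toLp] with t h1 h2 h3 h4
    rw [h4, RCLike.inner_apply]
    by_cases htR : t ∈ R
    · have h5 : ((Real.sqrt (q t) : ℝ) : ℂ) ≠ 0 :=
        Complex.ofReal_ne_zero.2 (Real.sqrt_pos.2 (hq_inf.trans_le (h3 (hRΩ htR)).1)).ne'
      rw [(mul_eq_zero.1 (h2.symm.trans h1)).resolve_left h5, map_zero, mul_zero]
      rfl
    · rw [normInd_of_notMem htR, zero_mul, Complex.ofReal_zero, zero_mul]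
      rfl
  · have h1 : AEMeasurable (fun y => 1 / q y * normInd R y) (volume.restrict R) :=
      (aemeasurable_const.div hq_meas.restrict).mul
        ((measurable_const.indicator hR_meas).const_mul _).aemeasurable
    have : IsFiniteMeasure (volume.restrict R) := isFiniteMeasure_restrict.2 hR_fin
    refine Integrable.of_bound h1.aestronglyMeasurable (1 / q_inf * (volume.real R)⁻¹) ?_
    filter_upwards [ae_restrict_of_ae_restrict_of_subset hRB hq_in, ae_restrict_mem hR_meas]
      with y hy hyR
    have hy' := (hy (hRΩ hyR)).1
    have hqy : 0 < q y := hq_inf.trans_le hy'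
    rw [normInd_of_mem hyR, Real.norm_eq_abs, abs_of_nonneg (by positivity)]
    gcongr
  · have h1 : ‖hhL.toLp‖ ^ 2 =
        ∫ y, (normInd R y * (Real.sqrt (q y))⁻¹) ^ 2 ∂(measB d) := by
      have h2 := inner_self_eq_norm_sq_to_K (𝕜 := ℂ) hhL.toLp
      rw [L2.inner_def] at h2
      have h3 : ∫ y, ⟪(MemLp.toLp _ hhL) y, (MemLp.toLp _ hhL) y⟫_ℂ ∂(measB d) =
          ∫ y, (((normInd R y * (Real.sqrt (q y))⁻¹) ^ 2 : ℝ) : ℂ) ∂(measB d) := by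
        refine integral_congr_ae ?_
        filter_upwards [hhL.coeFn_toLp] with y hy
        rw [hy, RCLike.inner_apply, Complex.conj_ofReal, ← Complex.ofReal_mul, sq]
      rw [h3, integral_complex_ofReal] at h2
      have h4 : ((∫ y, (normInd R y * (Real.sqrt (q y))⁻¹) ^ 2 ∂(measB d) : ℝ) : ℂ) =
        ((‖hhL.toLp‖ ^ 2 : ℝ) : ℂ) := by rw [h2]; push_cast; rfl
      exact (Complex.ofReal_injective h4).symm
    have h5 : ∫ y, (normInd R y * (Real.sqrt (q y))⁻¹) ^ 2 ∂(measB d) =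
        ∫ y in R, (normInd R y * (Real.sqrt (q y))⁻¹) ^ 2 := by
      refine (setIntegral_eq_of_subset_of_forall_sdiff_eq_zero measurableSet_ball hRB
        fun y hy => ?_)
      rw [normInd_of_notMem hy.2, zero_mul, zero_pow two_ne_zero]
    rw [h1, h5, ← integral_const_mul]
    refine integral_congr_ae ?_
    filter_upwards [ae_restrict_of_ae_restrict_of_subset hRB hq_abs, ae_restrict_mem hR_meas]
      with y hy hyR
    rw [normInd_of_mem hyR, mul_pow, inv_pow, inv_pow, Real.sq_sqrt hy.1]
    field_simp

end Factorization

end BornFM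

/-! ### Assembly of the main theorem -/

open BornFM in
theorem mainTheorem4 (d : ℕ) (hd : d = 1 ∨ d = 2) (c : ℝ) (hc : 0 < c)
    (Ω : Set (Rd d)) (hΩ : IsOpen Ω) (hΩB : Ω ⊆ unitB d)
    (q : Rd d → ℝ) (hq_meas : AEMeasurable q volume)
    (hq_supp : ∀ᵐ y ∂(volume.restrict Ωᶜ), q y = 0)
    (q_inf q_sup : ℝ) (hq_inf : 0 < q_inf)
    (hq : ∀ᵐ y ∂(volume.restrict Ω), q_inf ≤ q y ∧ q y ≤ q_sup)
    (R : Set (Rd d)) (hR_meas : MeasurableSet R) (hR_pos : 0 < volume R)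
    (hRΩ : closure R ⊆ Ω) :
    (∃ (ζ : HilbertBasis ℕ ℂ (L2B d)) (μ : ℕ → ℝ), IsEigensystem (dataOp c q) ζ μ) ∧
    ∃ gFM : L2B d,
      (opSqrt (dataOp c q) gFM = testFun c R ∧
        ∀ g : L2B d, opSqrt (dataOp c q) g = testFun c R → g = gFM) ∧
      (IntegrableOn (fun y => 1 / q y * normInd R y) R volume ∧
        volume.real R * ‖gFM‖ ^ 2 = ∫ y in R, 1 / q y * normInd R y) ∧
      ∀ (ζ : HilbertBasis ℕ ℂ (L2B d)) (μ : ℕ → ℝ), IsEigensystem (dataOp c q) ζ μ →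
        ∀ (f : ℝ → ℝ → ℝ) (d₀ : ℝ), IsRegularizingFilter f d₀ →
          (∀ α, 0 < α → ∀ h : L2B d, Summable (regTerm ζ μ f α h)) ∧
          ∃ ℓ : ℂ,
            Tendsto (fun α => (inner ℂ (dataOp c q (regularize ζ μ f α (testFun c R)))
                (regularize ζ μ f α (testFun c R)) : ℂ)) (𝓝[>] 0) (𝓝 ℓ) ∧
            (volume.real R : ℂ) * ℓ = ((volume.real R * ‖gFM‖ ^ 2 : ℝ) : ℂ) := by
  have hd0 : d ≠ 0 := by omega
  obtain ⟨A, h, hN, hφ, hAinj, hh, hint, hnorm⟩ := exists_factorization hc.ne' hΩ hΩB hq_meas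
    hq_supp hq_inf hq hR_meas hR_pos (subset_closure.trans hRΩ)
  have hpos : (dataOp c q).IsPositive := by
    rw [hN]; exact ContinuousLinearMap.isPositive_adjoint_comp_self A
  have hnormA : ∀ g, ‖opSqrt (dataOp c q) g‖ = ‖A g‖ := fun g => by
    rw [hN]; exact norm_opSqrt_adjoint_comp_self A g
  have hsinj : ∀ g, opSqrt (dataOp c q) g = 0 → g = 0 := fun g hg =>
    hAinj g (norm_eq_zero.1 (by rw [← hnormA, hg, norm_zero]))
  -- Injectivity passes from `A` to `N^{1/2}` by equality of norms, then to `N = N^{1/2} N^{1/2}`.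
  have hNinj : ∀ g, dataOp c q g = 0 → g = 0 := fun g hg =>
    hsinj g (hsinj _ (by rw [opSqrt_apply_opSqrt hpos, hg]))
  obtain ⟨gFM, hg, hgn⟩ := exists_opSqrt_eq_adjoint_apply A hh
  rw [← hN, ← hφ] at hg
  refine ⟨?_, gFM, ⟨hg, fun g hg' => ?_⟩, ⟨hint, by rw [hgn, hnorm]⟩, fun ζ μ hE f d₀ hf =>
    ⟨fun α hα x => summable_regTerm hE hf hα x, _, tendsto_inner_regularize hpos hE hf hg, by
      push_cast; rfl⟩⟩
  · obtain ⟨ζ, μ, h1, h2, h3⟩ := exists_hilbertBasis_eigenvectors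
      (isCompactOperator_kernelOp _ _ : IsCompactOperator (dataOp c q)) hpos hNinj
      (not_finiteDimensional_L2B hd0)
    exact ⟨ζ, μ, h1, h2, h3⟩
  · rw [← sub_eq_zero]
    exact hsinj _ (by rw [map_sub, hg', hg, sub_self])
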